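/- Let $a\in\mathbb{R}$, let $\Phi:[0,\infty)\to\mathbb{R}$ be in $L^\infty_{\mathrm{loc}}([0,\infty))$ (measurable and essentially bounded on every compact interval), and let $u_0\in H^1(\mathbb{R})$. Write $K(t,x)=(4\pi t)^{-1/2}e^{-x^2/(4t)}$ for the heat kernel and $(e^{t\Delta}f)(x)=\int_{\mathbb{R}}K(t,x-y)f(y)\,dy$, so that $e^{t\Delta}\delta_0=K(t,\cdot)$ for $t>0$. Let $u$ be a mild solution of $$\partial_t u=\partial_x^2u+\bigl(\Phi(t)-a[u(t,1)+u(t,-1)]\bigr)\delta_0\quad\text{on }(0,\infty)\times\mathbb{R},\qquad u(0,\cdot)=u_0,$$ that is, $u:[0,\infty)\to H^1(\mathbb{R})$ is continuous, $u(0)=u_0$, and for all $t>0$ $$u(t)=e^{t\Delta}u_0+\int_0^t\bigl(\Phi(\tau)-a[u(\tau,1)+u(\tau,-1)]\bigr)\,e^{(t-\tau)\Delta}\delta_0\,d\tau$$ as a Bochner integral in $H^1(\mathbb{R})$. Here $u(t,x)$ is the value at $x$ of the continuous representative of $u(t)$. Put $$u_+(t)=u(t,1)+u(t,-1),\qquad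 u_-(t)=u(t,1)-u(t,-1).$$ **Proposition 5.1.** Suppose that the (weak) derivatives $u_+'$ and $u_-'$ on $(0,\infty)$ belong to $L^1(0,\infty)$ and that the finite limits $\lim_{t\to+\infty}u_+(t)$ and $\lim_{t\to+\infty}u_-(t)$ exist. Then $\lim_{t\to+\infty}u(t,1)$ and $\lim_{t\to+\infty}u(t,-1)$ exist, and $$\lim_{t\to+\infty}u(t,x)=\lim_{t\to+\infty}u(t,1)\ \text{ for every }x\ge 1,\qquad \lim_{t\to+\infty}u(t,x)=\lim_{t\to+\infty}u(t,-1)\ \text{ for every }x\le -1 .$$ -/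

import Mathlib

open MeasureTheory Filter Topology Set
open scoped ContDiff

noncomputable section

namespace DiracHeat

/-- `g` is a weak (distributional) derivative of `f` on the open set `Ω ⊆ ℝ`. -/
def IsWeakDerivOn (Ω : Set ℝ) (f g : ℝ → ℝ) : Prop :=
  LocallyIntegrableOn f Ω ∧ LocallyIntegrableOn g Ω ∧
    ∀ φ : ℝ → ℝ, ContDiff ℝ ∞ φ → HasCompactSupport φ → tsupport φ ⊆ Ω →
      ∫ x, f x * deriv φ x = - ∫ x, g x * φ x

/-! ### The Sobolev space `H¹(ℝ)` -/

/-- The space `L²(ℝ)` of real-valued functions. -/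
abbrev L2 : Type := Lp ℝ 2 (volume : Measure ℝ)

theorem L2_integral_mul_eq_inner (f : L2) {ψ : ℝ → ℝ} (hψ : MemLp ψ 2 volume) :
    ∫ x, f x * ψ x = inner ℝ (hψ.toLp ψ) f := by
  rw [L2.inner_def]
  refine integral_congr_ae ?_
  filter_upwards [hψ.coeFn_toLp] with x hx
  simp [hx]

theorem memLp_two_test {φ : ℝ → ℝ} (h : Continuous φ) (hc : HasCompactSupport φ) :
    MemLp φ 2 volume := h.memLp_of_hasCompactSupport hc

theorem memLp_two_test_deriv {φ : ℝ → ℝ} (h : ContDiff ℝ ∞ φ) (hc : HasCompactSupport φ) :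
    MemLp (deriv φ) 2 volume :=
  memLp_two_test (h.continuous_deriv (by simp)) hc.deriv

theorem L2_locallyIntegrable (f : L2) : LocallyIntegrable f volume :=
  (Lp.memLp f).locallyIntegrable (by norm_num)

/-- For elements of `L²(ℝ)`, being a weak derivative is a family of closed linear conditions. -/
theorem isWeakDerivOn_univ_iff (f g : L2) :
    IsWeakDerivOn univ f g ↔ ∀ φ : ℝ → ℝ, ∀ (h : ContDiff ℝ ∞ φ) (hc : HasCompactSupport φ),
      inner ℝ ((memLp_two_test_deriv h hc).toLp _) f
        + inner ℝ ((memLp_two_test h.continuous hc).toLp _) g = 0 := by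
  constructor
  · intro H φ h hc
    rw [← L2_integral_mul_eq_inner, ← L2_integral_mul_eq_inner, H.2.2 φ h hc (subset_univ _)]
    ring
  · intro H
    refine ⟨(L2_locallyIntegrable f).locallyIntegrableOn _,
      (L2_locallyIntegrable g).locallyIntegrableOn _, fun φ h hc _ => ?_⟩
    have := H φ h hc
    rw [← L2_integral_mul_eq_inner, ← L2_integral_mul_eq_inner] at this
    linarith

/-- The Sobolev space `H¹(ℝ)`: all pairs `(f, g)` in `L²(ℝ) × L²(ℝ)` such that `g` is the weak
derivative of `f` (so `g` is determined by `f`), with the norm `(‖f‖² + ‖g‖²)^(1/2)`. -/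
def H1 : Submodule ℝ (WithLp 2 (L2 × L2)) where
  carrier := {F | IsWeakDerivOn univ F.fst F.snd}
  zero_mem' := by
    simp only [mem_ofPred_eq, isWeakDerivOn_univ_iff]
    intro φ h hc
    simp
  add_mem' := by
    intro F G hF hG
    simp only [mem_ofPred_eq, isWeakDerivOn_univ_iff] at *
    intro φ h hc
    have h1 := hF φ h hc
    have h2 := hG φ h hc
    simp only [WithLp.add_fst, WithLp.add_snd, inner_add_right]
    linarith
  smul_mem' := by
    intro c F hF
    simp only [mem_ofPred_eq, isWeakDerivOn_univ_iff] at *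
    intro φ h hc
    have h1 := hF φ h hc
    simp only [WithLp.smul_fst, WithLp.smul_snd, inner_smul_right]
    rw [← mul_add, h1, mul_zero]

theorem isClosed_H1 : IsClosed (H1 : Set (WithLp 2 (L2 × L2))) := by
  have : (H1 : Set (WithLp 2 (L2 × L2))) =
      ⋂ (φ : ℝ → ℝ) (h : ContDiff ℝ ∞ φ) (hc : HasCompactSupport φ), {F : WithLp 2 (L2 × L2) |
      inner ℝ ((memLp_two_test_deriv h hc).toLp _) F.fst
        + inner ℝ ((memLp_two_test h.continuous hc).toLp _) F.snd = 0} := by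
    ext F
    simp only [mem_iInter, mem_ofPred_eq]
    exact isWeakDerivOn_univ_iff _ _
  rw [this]
  refine isClosed_iInter fun φ => isClosed_iInter fun h => isClosed_iInter fun hc => ?_
  refine isClosed_eq ?_ continuous_const
  have c1 : Continuous fun F : WithLp 2 (L2 × L2) => F.fst :=
    (WithLp.fstL 2 ℝ L2 L2).continuous
  have c2 : Continuous fun F : WithLp 2 (L2 × L2) => F.snd :=
    (WithLp.sndL 2 ℝ L2 L2).continuous
  exact (continuous_const.inner c1).add (continuous_const.inner c2)

/-- `H¹(ℝ)` is complete, so that Bochner integrals with values in it make sense. -/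
instance : CompleteSpace H1 := isClosed_H1.completeSpace_coe

/-! ### Point values of elements of `H¹(ℝ)` -/

theorem exists_Icc_of_hasCompactSupport {φ : ℝ → ℝ} (hc : HasCompactSupport φ) :
    ∃ R : ℝ, 0 < R ∧ tsupport φ ⊆ Ioc (-R) R := by
  obtain ⟨R, hR⟩ := hc.isCompact.isBounded.subset_closedBall 0
  refine ⟨|R| + 1, by positivity, fun x hx => ?_⟩
  have h1 := hR hx
  rw [Metric.mem_closedBall, Real.dist_0_eq_abs] at h1
  have h2 := le_abs_self R
  have h3 := abs_le.1 (h1.trans h2)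
  constructor <;> linarith [h3.1, h3.2]

/-- A locally integrable function whose weak derivative vanishes is almost everywhere constant. -/
theorem ae_const_of_weakDeriv_zero {h : ℝ → ℝ} (hh : LocallyIntegrable h volume)
    (H : ∀ φ : ℝ → ℝ, ContDiff ℝ ∞ φ → HasCompactSupport φ → ∫ x, h x * deriv φ x = 0) :
    ∃ c : ℝ, ∀ᵐ x, h x = c := by
  obtain ⟨η, hη, hηc, hη1⟩ : ∃ η : ℝ → ℝ, ContDiff ℝ ∞ η ∧ HasCompactSupport η ∧
      ∫ x, η x = 1 := by
    let b : ContDiffBump (0 : ℝ) := default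
    exact ⟨b.normed volume, b.contDiff_normed, b.hasCompactSupport_normed, b.integral_normed⟩
  refine ⟨∫ x, h x * η x, ?_⟩
  refine ae_eq_of_integral_contDiff_smul_eq hh (locallyIntegrable_const _) ?_
  intro ψ hψ hψc
  set c : ℝ := ∫ x, ψ x with hc
  set θ : ℝ → ℝ := fun x => ψ x - c * η x with hθ
  have iψ : Integrable ψ := hψ.continuous.integrable_of_hasCompactSupport hψc
  have iη : Integrable η := hη.continuous.integrable_of_hasCompactSupport hηc
  have hθs : ContDiff ℝ ∞ θ := hψ.sub (contDiff_const.mul hη)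
  have hθi : Integrable θ := iψ.sub (iη.const_mul c)
  have hθ0 : ∫ x, θ x = 0 := by
    rw [hθ, integral_sub iψ (iη.const_mul c), integral_const_mul, hη1, hc]; ring
  have hθc : HasCompactSupport θ := hψc.sub (hηc.mul_left)
  obtain ⟨R, hR, hsub⟩ := exists_Icc_of_hasCompactSupport hθc
  have hθz : ∀ x, x ∉ Ioc (-R) R → θ x = 0 := fun x hx =>
    image_eq_zero_of_notMem_tsupport fun h' => hx (hsub h')
  let φ : ℝ → ℝ := fun x => ∫ y in (-R)..x, θ y
  have hφd : ∀ x, HasDerivAt φ (θ x) x := fun x =>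
    intervalIntegral.integral_hasDerivAt_right (hθi.intervalIntegrable)
      (hθs.continuous.stronglyMeasurableAtFilter _ _) hθs.continuous.continuousAt
  have hφ' : deriv φ = θ := funext fun x => (hφd x).deriv
  have hφs : ContDiff ℝ ∞ φ := by
    rw [contDiff_infty_iff_deriv, hφ']
    exact ⟨fun x => (hφd x).differentiableAt, hθs⟩
  have hφc : HasCompactSupport φ := by
    refine HasCompactSupport.intro (K := Icc (-R) R) isCompact_Icc fun x hx => ?_
    rcases lt_or_ge x (-R) with hlt | hge
    · change ∫ y in (-R)..x, θ y = 0
      rw [intervalIntegral.integral_symm, neg_eq_zero]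
      refine intervalIntegral.integral_zero_ae (ae_of_all _ fun y hy => hθz y fun h' => ?_)
      rw [uIoc_of_le hlt.le] at hy
      linarith [hy.2, h'.1]
    · have hxR : R < x := by
        by_contra h'
        exact hx ⟨hge, not_lt.1 h'⟩
      change ∫ y in (-R)..x, θ y = 0
      rw [intervalIntegral.integral_of_le hge, ← hθ0]
      refine setIntegral_eq_integral_of_forall_compl_eq_zero fun y hy => hθz y fun h' => ?_
      exact hy ⟨h'.1, h'.2.trans hxR.le⟩
  have key := H φ hφs hφc
  rw [hφ'] at key
  have i1 : Integrable fun x => ψ x • h x :=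
    hh.integrable_smul_left_of_hasCompactSupport hψ.continuous hψc
  have i2 : Integrable fun x => η x • h x :=
    hh.integrable_smul_left_of_hasCompactSupport hη.continuous hηc
  have e : ∀ x, h x * θ x = ψ x • h x - c * (η x • h x) := fun x => by
    simp only [hθ, smul_eq_mul]; ring
  simp only [e] at key
  rw [integral_sub i1 (i2.const_mul c), integral_const_mul] at key
  have e2 : ∫ x, h x * η x = ∫ x, η x • h x := by simp only [smul_eq_mul, mul_comm]
  have e3 : ∫ x, ψ x • (∫ x, h x * η x) = c * ∫ x, η x • h x := by
    simp only [smul_eq_mul] at e2 ⊢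
    rw [integral_mul_const, e2]
  rw [e3]
  linarith

theorem locallyIntegrable_intervalIntegrable {g : ℝ → ℝ} (hg : LocallyIntegrable g volume)
    (a b : ℝ) : IntervalIntegrable g volume a b :=
  (hg.integrableOn_isCompact isCompact_uIcc).intervalIntegrable

/-- Integration by parts for the primitive of a locally integrable function. -/
theorem integral_primitive_mul_deriv {g : ℝ → ℝ} (hg : LocallyIntegrable g volume)
    {φ : ℝ → ℝ} (hφ : ContDiff ℝ ∞ φ) (hc : HasCompactSupport φ) :
    ∫ x, (∫ y in (0 : ℝ)..x, g y) * deriv φ x = - ∫ x, g x * φ x := by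
  obtain ⟨R, hR, hsub⟩ := exists_Icc_of_hasCompactSupport hc
  have hgi : ∀ a b : ℝ, IntervalIntegrable g volume a b := fun a b =>
    locallyIntegrable_intervalIntegrable hg a b
  set G : ℝ → ℝ := fun x => ∫ y in (0 : ℝ)..x, g y with hG
  have hGac : AbsolutelyContinuousOnInterval G (-R) R :=
    (hgi (-R) R).absolutelyContinuousOnInterval_intervalIntegral
      (by rw [uIcc_of_le (by linarith)]; constructor <;> linarith)
  have hφac : AbsolutelyContinuousOnInterval φ (-R) R :=
    ((hφ.of_le (by simp)).contDiffOn).absolutelyContinuousOnInterval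
  have ibp := hGac.integral_mul_deriv_eq_deriv_mul hφac
  have z1 : ∀ x, x ∉ Ioc (-R) R → φ x = 0 := fun x hx =>
    image_eq_zero_of_notMem_tsupport fun h' => hx (hsub h')
  have z2 : ∀ x, x ∉ Ioc (-R) R → deriv φ x = 0 := fun x hx =>
    image_eq_zero_of_notMem_tsupport fun h' => hx (hsub (tsupport_deriv_subset h'))
  have zl : φ (-R) = 0 := z1 _ fun h' => lt_irrefl _ h'.1
  have zr : φ R = 0 := by
    by_contra h'
    have hnb : ∀ᶠ x in 𝓝 R, φ x ≠ 0 := hφ.continuous.continuousAt.eventually_ne h'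
    obtain ⟨ε, hε, hb⟩ := Metric.eventually_nhds_iff.1 hnb
    refine hb (y := R + ε / 2) ?_ (z1 _ fun h'' => ?_)
    · rw [Real.dist_eq, add_sub_cancel_left, abs_of_pos (by linarith)]; linarith
    · linarith [h''.2]
  rw [zl, zr, intervalIntegral.integral_of_le (by linarith),
    intervalIntegral.integral_of_le (by linarith)] at ibp
  rw [setIntegral_eq_integral_of_forall_compl_eq_zero
    (fun x hx => by rw [z2 x hx, mul_zero])] at ibp
  rw [setIntegral_eq_integral_of_forall_compl_eq_zero
    (fun x hx => by rw [z1 x hx, mul_zero])] at ibp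
  rw [ibp]
  have : ∫ x, deriv G x * φ x = ∫ x, g x * φ x := by
    refine integral_congr_ae ?_
    filter_upwards [LocallyIntegrable.ae_hasDerivAt_integral hg] with x hx
    rw [(hx 0).deriv]
  rw [this]
  ring

/-- Sobolev embedding in dimension one: every element of `H¹(ℝ)` has a continuous
representative. -/
theorem exists_continuous_rep (v : H1) :
    ∃ w : ℝ → ℝ, Continuous w ∧ w =ᵐ[volume] (v : WithLp 2 (L2 × L2)).fst := by
  obtain ⟨hf, hg, H⟩ := v.2
  rw [locallyIntegrableOn_univ] at hf hg
  set f : ℝ → ℝ := ⇑(v : WithLp 2 (L2 × L2)).fst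
  set g : ℝ → ℝ := ⇑(v : WithLp 2 (L2 × L2)).snd
  have hGc : Continuous fun x : ℝ => ∫ y in (0 : ℝ)..x, g y :=
    intervalIntegral.continuous_primitive (locallyIntegrable_intervalIntegrable hg) 0
  obtain ⟨c, hc⟩ := ae_const_of_weakDeriv_zero (hf.sub hGc.locallyIntegrable) (by
    intro φ hφ hφc
    have hd : Continuous (deriv φ) := hφ.continuous_deriv (by simp)
    have i1 : Integrable fun x => f x * deriv φ x := by
      simpa [mul_comm] using hf.integrable_smul_left_of_hasCompactSupport hd hφc.deriv
    have i2 : Integrable fun x => (∫ y in (0 : ℝ)..x, g y) * deriv φ x :=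
      (hGc.mul hd).integrable_of_hasCompactSupport hφc.deriv.mul_left
    simp only [Pi.sub_apply, sub_mul]
    rw [integral_sub i1 i2, integral_primitive_mul_deriv hg hφ hφc,
      H φ hφ hφc (subset_univ _)]
    ring)
  refine ⟨fun x => c + ∫ y in (0 : ℝ)..x, g y, continuous_const.add hGc, ?_⟩
  filter_upwards [hc] with x hx
  simp only [Pi.sub_apply] at hx
  linarith

/-- The (unique) continuous representative of an element of `H¹(ℝ)`; `pt v x` is the value
`v(x)` of `v` at the point `x`. -/
def pt (v : H1) : ℝ → ℝ := (exists_continuous_rep v).choose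

theorem continuous_pt (v : H1) : Continuous (pt v) := (exists_continuous_rep v).choose_spec.1

theorem pt_ae_eq (v : H1) : pt v =ᵐ[volume] (v : WithLp 2 (L2 × L2)).fst :=
  (exists_continuous_rep v).choose_spec.2

/-- The continuous representative is unique. -/
theorem pt_eq_of_ae_eq {v : H1} {w : ℝ → ℝ} (hw : Continuous w)
    (h : w =ᵐ[volume] (v : WithLp 2 (L2 × L2)).fst) : pt v = w :=
  (continuous_pt v).ae_eq_iff_eq volume hw |>.1 ((pt_ae_eq v).trans h.symm)

/-! ### The heat kernel and the heat semigroup -/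

/-- The heat kernel `K(t, x) = exp(-x² / (4t)) / √(4πt)` on `ℝ`, for `t > 0`. -/
def heatKernel (t x : ℝ) : ℝ := Real.exp (-x ^ 2 / (4 * t)) / Real.sqrt (4 * Real.pi * t)

/-- The spatial derivative of the heat kernel. -/
def heatKernelDeriv (t x : ℝ) : ℝ := -x / (2 * t) * heatKernel t x

theorem hasDerivAt_heatKernel (t x : ℝ) :
    HasDerivAt (heatKernel t) (heatKernelDeriv t x) x := by
  unfold heatKernelDeriv heatKernel
  have h0 : HasDerivAt (fun y : ℝ => y ^ 2) (2 * x) x := by simpa using hasDerivAt_pow 2 x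
  have h1 : HasDerivAt (fun y : ℝ => -y ^ 2 / (4 * t)) (-(2 * x) / (4 * t)) x :=
    h0.neg.div_const (4 * t)
  have h2 : -(2 * x) / (4 * t) = -x / (2 * t) := by
    rw [show (4 : ℝ) * t = 2 * (2 * t) by ring, show -(2 * x) = 2 * -x by ring,
      mul_div_mul_left _ _ two_ne_zero]
  rw [h2] at h1
  have h := h1.exp.div_const (Real.sqrt (4 * Real.pi * t))
  rwa [mul_comm (Real.exp _), mul_div_assoc] at h

theorem memLp_heatKernel {t : ℝ} (ht : 0 < t) : MemLp (heatKernel t) 2 volume := by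
  have hc : Continuous (heatKernel t) :=
    continuous_iff_continuousAt.2 fun x => (hasDerivAt_heatKernel t x).continuousAt
  rw [memLp_two_iff_integrable_sq hc.aestronglyMeasurable]
  have h := (integrable_exp_neg_mul_sq (b := 1 / (2 * t)) (by positivity)).const_mul
    ((Real.sqrt (4 * Real.pi * t))⁻¹ ^ 2)
  refine h.congr (ae_of_all _ fun x => ?_)
  simp only [heatKernel, div_eq_mul_inv (Real.exp _), mul_pow, ← Real.exp_nat_mul]
  rw [mul_comm]
  congr 2
  push_cast
  field_simp
  ring

theorem memLp_heatKernelDeriv {t : ℝ} (ht : 0 < t) :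
    MemLp (heatKernelDeriv t) 2 volume := by
  have hc : Continuous (heatKernel t) :=
    continuous_iff_continuousAt.2 fun x => (hasDerivAt_heatKernel t x).continuousAt
  have hc' : Continuous (heatKernelDeriv t) := by
    unfold heatKernelDeriv
    fun_prop
  rw [memLp_two_iff_integrable_sq hc'.aestronglyMeasurable]
  have h := (integrable_rpow_mul_exp_neg_mul_sq (b := 1 / (2 * t)) (by positivity)
    (s := 2) (by norm_num)).const_mul (((2 * t)⁻¹ * (Real.sqrt (4 * Real.pi * t))⁻¹) ^ 2)
  refine h.congr (ae_of_all _ fun x => ?_)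
  have e : Real.exp (-(1 / (2 * t)) * x ^ 2) = Real.exp (-x ^ 2 / (4 * t)) ^ 2 := by
    rw [← Real.exp_nat_mul]
    congr 1
    push_cast
    field_simp
    ring
  beta_reduce
  rw [e]
  simp only [heatKernelDeriv, heatKernel, Real.rpow_two, div_eq_mul_inv]
  generalize Real.exp _ = E
  ring

/-- A differentiable function that is in `L²(ℝ)` together with its derivative is in `H¹(ℝ)`. -/
theorem mem_H1_of_hasDerivAt {f f' : ℝ → ℝ} (hd : ∀ x, HasDerivAt f (f' x) x)
    (hf : MemLp f 2 volume) (hf' : MemLp f' 2 volume) :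
    WithLp.toLp 2 (hf.toLp f, hf'.toLp f') ∈ H1 := by
  change IsWeakDerivOn univ (hf.toLp f) (hf'.toLp f')
  refine ⟨(L2_locallyIntegrable _).locallyIntegrableOn _,
    (L2_locallyIntegrable _).locallyIntegrableOn _, fun φ hφ hc _ => ?_⟩
  have e1 : ∫ x, (hf.toLp f : ℝ → ℝ) x * deriv φ x = ∫ x, f x * deriv φ x :=
    integral_congr_ae (by filter_upwards [hf.coeFn_toLp] with x hx; rw [hx])
  have e2 : ∫ x, (hf'.toLp f' : ℝ → ℝ) x * φ x = ∫ x, f' x * φ x :=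
    integral_congr_ae (by filter_upwards [hf'.coeFn_toLp] with x hx; rw [hx])
  rw [e1, e2]
  have m1 := memLp_two_test hφ.continuous hc
  have m2 := memLp_two_test_deriv hφ hc
  exact integral_mul_deriv_eq_deriv_mul_of_integrable (fun x _ => hd x)
    (fun x _ => (hφ.differentiable (by simp) x).hasDerivAt)
    (hf.integrable_mul m2) (hf'.integrable_mul m1) (hf.integrable_mul m1)

/-- `e^{tΔ} δ₀` for `t > 0`: the heat kernel `K(t, ·)` as an element of `H¹(ℝ)`
(set to `0` for `t ≤ 0`, where it is never used). -/
def heatDirac (t : ℝ) : H1 :=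
  if ht : 0 < t then
    ⟨WithLp.toLp 2 ((memLp_heatKernel ht).toLp _, (memLp_heatKernelDeriv ht).toLp _),
      mem_H1_of_hasDerivAt (hasDerivAt_heatKernel t) _ _⟩
  else 0

/-- `v = e^{tΔ} f` for `t > 0` and `f ∈ H¹(ℝ)`, where the heat semigroup is
`(e^{tΔ} f)(x) = ∫ K(t, x - y) f(y) dy`. -/
def IsHeatFlow (t : ℝ) (f v : H1) : Prop :=
  ∀ᵐ x, pt v x = ∫ y, heatKernel t (x - y) * pt f y

/-! ### The system and its mild solutions -/

/-- `Φ ∈ L^∞_loc(ℝ₀⁺)`: essentially bounded (and a.e. strongly measurable) on every compact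
interval `[0, T]`. -/
def LocBounded (Φ : ℝ → ℝ) : Prop :=
  ∀ T : ℝ, 0 < T → MemLp Φ ⊤ (volume.restrict (Icc 0 T))

/-- The intensity of the Dirac source, `Ψ(t) = Φ(t) - a (u(t, 1) + u(t, -1))`. -/
def source (a : ℝ) (Φ : ℝ → ℝ) (u : ℝ → H1) (t : ℝ) : ℝ :=
  Φ t - a * (pt (u t) 1 + pt (u t) (-1))

/-- `u : [0, ∞) → H¹(ℝ)` is a mild solution of `∂ₜ u = ∂ₓ² u + Ψ(t) δ₀`, `u(0) = u₀`, with
`Ψ(t) = Φ(t) - a (u(t, 1) + u(t, -1))`: it is continuous and satisfies the variation of constants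
formula `u(t) = e^{tΔ} u₀ + ∫₀ᵗ Ψ(τ) e^{(t - τ)Δ} δ₀ dτ`, with a Bochner integral in `H¹(ℝ)`.
Values of `u` at negative times play no role. -/
structure IsMildSolution (a : ℝ) (Φ : ℝ → ℝ) (u₀ : H1) (u : ℝ → H1) : Prop where
  continuousOn : ContinuousOn u (Ici 0)
  initial : u 0 = u₀
  integrable : ∀ t : ℝ, 0 < t →
    IntervalIntegrable (fun τ => source a Φ u τ • heatDirac (t - τ)) volume 0 t
  variation_of_constants : ∀ t : ℝ, 0 < t →
    IsHeatFlow t u₀ (u t - ∫ τ in (0 : ℝ)..t, source a Φ u τ • heatDirac (t - τ))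

/-- `f' ∈ L¹(ℝ₀⁺)`, for the weak derivative `f'` of `f` on `(0, ∞)`. -/
def HasIntegrableDeriv (f : ℝ → ℝ) : Prop :=
  ∃ g : ℝ → ℝ, IsWeakDerivOn (Ioi 0) f g ∧ IntegrableOn g (Ioi 0)

end DiracHeat

end

noncomputable section

namespace DiracHeat

/-! ### Improper integrals of nonnegative derivatives -/

/-! The sum and difference `u_±` determine the traces at `±1`, so these traces converge. The work is
to carry the limit from a boundary point to the whole half-line beyond it.

Subtract the free heat flow: `w = u - e^{tΔ}u₀` is a heat potential of a source at the origin, so on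
the half-line it solves the heat equation with zero initial data. It is therefore recovered from its
boundary trace by a Volterra convolution: at distance `y` from the boundary, `w(t) = ∫₀ᵗ p(t - σ)
w_bdry(σ) dσ` with `p(t) = y t⁻¹ K(t, y)`. No uniqueness theorem is needed. The formula follows by
Fubini from `p * K(·, 1) = K(·, y + 1)` (`integral_boundaryKernel_mul_heatKernel`,
`integral_boundaryKernel_mul_potential`).

Since `p ≥ 0` has total mass one (`boundaryKernel_integral`), dominated convergence makes the
convolution inherit the limit of the trace (`tendsto_integral_boundaryKernel`). The free flow decays
at every point (`tendsto_heatFlow`), so `u` has the same limit. `IsMildSolution.tendsto_pt` combines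
these facts on either half-line. -/

theorem intervalIntegral_of_hasDerivAt_of_tendsto_of_nonneg {f f' : ℝ → ℝ} {a b fa fb : ℝ}
    (hab : a < b) (hd : ∀ x ∈ Ioo a b, HasDerivAt f (f' x) x) (h0 : ∀ x ∈ Ioo a b, 0 ≤ f' x)
    (ha : Tendsto f (𝓝[>] a) (𝓝 fa)) (hb : Tendsto f (𝓝[<] b) (𝓝 fb)) :
    IntervalIntegrable f' volume a b ∧ ∫ x in a..b, f' x = fb - fa := by
  have hc : ContinuousOn (extendFrom (Ioo a b) f) (Icc a b) :=
    continuousOn_Icc_extendFrom_Ioo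
      (fun x hx => (hd x hx).continuousAt.continuousWithinAt) ha hb
  have hd' : ∀ x ∈ Ioo a b, HasDerivAt (extendFrom (Ioo a b) f) (f' x) x := fun x hx => by
    refine (hd x hx).congr_of_eventuallyEq ?_
    filter_upwards [Ioo_mem_nhds hx.1 hx.2] with z hz
    exact extendFrom_eq (subset_closure hz) (hd z hz).continuousAt.continuousWithinAt
  have hi : IntervalIntegrable f' volume a b :=
    (intervalIntegrable_iff_integrableOn_Ioc_of_le hab.le).2
      (intervalIntegral.integrableOn_deriv_of_nonneg hc hd' h0)
  exact ⟨hi, intervalIntegral.integral_eq_sub_of_hasDerivAt_of_tendsto hab hd hi ha hb⟩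

/-- A nonnegative derivative means a monotone function, so finite limits at the ends already force
integrability. Only limits are assumed at the ends because the antiderivatives used below involve
quotients that are singular there. -/
theorem integral_Ioi_of_hasDerivAt_of_tendsto_of_nonneg {f f' : ℝ → ℝ} {a fa m : ℝ}
    (hd : ∀ x ∈ Ioi a, HasDerivAt f (f' x) x) (h0 : ∀ x ∈ Ioi a, 0 ≤ f' x)
    (ha : Tendsto f (𝓝[>] a) (𝓝 fa)) (hm : Tendsto f atTop (𝓝 m)) :
    IntegrableOn f' (Ioi a) ∧ ∫ x in Ioi a, f' x = m - fa := by
  have hc : ContinuousWithinAt (Function.update f a fa) (Ici a) a := by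
    rw [continuousWithinAt_update_same, Ici_sdiff_left]
    exact ha
  have hd' : ∀ x ∈ Ioi a, HasDerivAt (Function.update f a fa) (f' x) x := fun x hx => by
    refine (hd x hx).congr_of_eventuallyEq ?_
    filter_upwards [Ioi_mem_nhds hx] with z hz
    exact Function.update_of_ne (ne_of_gt hz) _ _
  have hm' : Tendsto (Function.update f a fa) atTop (𝓝 m) := by
    refine hm.congr' ?_
    filter_upwards [eventually_gt_atTop a] with z hz
    exact (Function.update_of_ne (ne_of_gt hz) _ _).symm
  refine ⟨integrableOn_Ioi_deriv_of_nonneg hc hd' h0 hm', ?_⟩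
  rw [integral_Ioi_of_hasDerivAt_of_nonneg hc hd' h0 hm', Function.update_self]

/-! ### The error function -/

/-- The primitive of `exp (-w ^ 2)` vanishing at the origin. -/
def gaussPrimitive (z : ℝ) : ℝ := ∫ w in (0 : ℝ)..z, Real.exp (-w ^ 2)

theorem hasDerivAt_gaussPrimitive (z : ℝ) :
    HasDerivAt gaussPrimitive (Real.exp (-z ^ 2)) z := by
  have hc : Continuous fun w : ℝ => Real.exp (-w ^ 2) := by fun_prop
  exact intervalIntegral.integral_hasDerivAt_right (hc.intervalIntegrable _ _)
    (hc.stronglyMeasurableAtFilter _ _) hc.continuousAt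

theorem tendsto_gaussPrimitive_atTop :
    Tendsto gaussPrimitive atTop (𝓝 (Real.sqrt Real.pi / 2)) := by
  have h1 := integrable_exp_neg_mul_sq (b := 1) one_pos
  have h2 := integral_gaussian_Ioi 1
  simp only [neg_mul, one_mul, div_one] at h1 h2
  rw [← h2]
  exact intervalIntegral_tendsto_integral_Ioi 0 h1.integrableOn tendsto_id

theorem gaussPrimitive_neg (z : ℝ) : gaussPrimitive (-z) = -gaussPrimitive z := by
  unfold gaussPrimitive
  rw [← intervalIntegral.integral_symm]
  have := intervalIntegral.integral_comp_neg (a := 0) (b := -z) fun w : ℝ => Real.exp (-w ^ 2)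
  simpa using this

theorem tendsto_gaussPrimitive_atBot :
    Tendsto gaussPrimitive atBot (𝓝 (-(Real.sqrt Real.pi / 2))) := by
  refine ((tendsto_gaussPrimitive_atTop.comp tendsto_neg_atBot_atTop).neg).congr fun z => ?_
  simp [gaussPrimitive_neg]

theorem gaussPrimitive_zero : gaussPrimitive 0 = 0 := by simp [gaussPrimitive]

/-! ### The boundary kernel of the half-line -/

/-- The kernel `p(t) = y t⁻¹ K(t, y)` of the Dirichlet problem for the heat equation on a half-line,
at distance `y` from the boundary. -/
def boundaryKernel (y t : ℝ) : ℝ := y / t * heatKernel t y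

theorem heatKernel_nonneg (t x : ℝ) : 0 ≤ heatKernel t x := by
  unfold heatKernel; positivity

theorem boundaryKernel_nonneg {y t : ℝ} (hy : 0 ≤ y) (ht : 0 ≤ t) : 0 ≤ boundaryKernel y t :=
  mul_nonneg (div_nonneg hy ht) (heatKernel_nonneg t y)

theorem sqrt_four_pi_mul {t : ℝ} :
    Real.sqrt (4 * Real.pi * t) = 2 * Real.sqrt Real.pi * Real.sqrt t := by
  rw [Real.sqrt_mul (by positivity), Real.sqrt_mul (by norm_num),
    show (4 : ℝ) = 2 ^ 2 by norm_num, Real.sqrt_sq (by norm_num)]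

theorem tendsto_sqrt_nhdsGT_zero : Tendsto Real.sqrt (𝓝[>] 0) (𝓝[>] 0) := by
  refine tendsto_nhdsWithin_iff.2 ⟨?_, ?_⟩
  · have := Real.continuous_sqrt.tendsto 0
    rw [Real.sqrt_zero] at this
    exact this.mono_left nhdsWithin_le_nhds
  · filter_upwards [self_mem_nhdsWithin] with x hx using Real.sqrt_pos.2 hx

theorem boundaryKernel_integral {y : ℝ} (hy : 0 < y) :
    IntegrableOn (boundaryKernel y) (Ioi 0) ∧ ∫ t in Ioi 0, boundaryKernel y t = 1 := by
  have hpi : 0 < Real.sqrt Real.pi := Real.sqrt_pos.2 Real.pi_pos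
  -- The substitution `w = y / (2√s)` turns the kernel into a Gaussian. The resulting
  -- antiderivative, a negative multiple of the error function, rises from `-1` to `0`.
  have key := integral_Ioi_of_hasDerivAt_of_tendsto_of_nonneg (a := 0) (fa := -1) (m := 0)
    (f := fun s => -(2 / Real.sqrt Real.pi) * gaussPrimitive (y / 2 * (Real.sqrt s)⁻¹))
    (f' := boundaryKernel y) ?_ (fun t ht => boundaryKernel_nonneg hy.le (le_of_lt ht)) ?_ ?_
  · simpa using key
  · intro s hs
    have hs : 0 < s := hs
    have hq : 0 < Real.sqrt s := Real.sqrt_pos.2 hs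
    have h1 := ((Real.hasDerivAt_sqrt hs.ne').inv hq.ne').const_mul (y / 2)
    have h2 := ((hasDerivAt_gaussPrimitive _).comp s h1).const_mul (-(2 / Real.sqrt Real.pi))
    refine h2.congr_deriv ?_
    have e : -(y / 2 * (Real.sqrt s)⁻¹) ^ 2 = -y ^ 2 / (4 * s) := by
      rw [mul_pow, inv_pow, Real.sq_sqrt hs.le]; field_simp; ring
    unfold boundaryKernel heatKernel
    simp only [Pi.inv_apply]
    rw [e, sqrt_four_pi_mul]
    generalize Real.exp _ = E
    have hsq : y / s = y / Real.sqrt s ^ 2 := by rw [Real.sq_sqrt hs.le]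
    rw [hsq]
    field_simp
  · have h1 : Tendsto (fun s => y / 2 * (Real.sqrt s)⁻¹) (𝓝[>] 0) atTop :=
      (tendsto_inv_nhdsGT_zero.comp tendsto_sqrt_nhdsGT_zero).const_mul_atTop (by positivity)
    have h2 := (tendsto_gaussPrimitive_atTop.comp h1).const_mul (-(2 / Real.sqrt Real.pi))
    have e : -(2 / Real.sqrt Real.pi) * (Real.sqrt Real.pi / 2) = -1 := by field_simp
    rwa [e] at h2
  · have h1 : Tendsto (fun s => y / 2 * (Real.sqrt s)⁻¹) atTop (𝓝 (y / 2 * 0)) :=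
      (tendsto_inv_atTop_zero.comp Real.tendsto_sqrt_atTop).const_mul _
    rw [mul_zero] at h1
    have h3 := (hasDerivAt_gaussPrimitive 0).continuousAt.tendsto
    rw [gaussPrimitive_zero] at h3
    simpa using (h3.comp h1).const_mul (-(2 / Real.sqrt Real.pi))

/-- Used with `P² = s - σ`, `Q² = σ`, `S² = s`. The arguments `A`, `B` of the two error functions
below are `(yQ/P ∓ cP/Q) / (2S)`, so `B² - A² = yc/S²`: the two Gaussians differ by a factor
independent of `σ`. -/
theorem heat_exponent_sub {P Q S y c : ℝ} (hP : 0 < P) (hQ : 0 < Q) (hS : 0 < S) :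
    y * c / S ^ 2 - ((y * (Q / P) + c * (P / Q)) / (2 * S)) ^ 2
      = -((y * (Q / P) - c * (P / Q)) / (2 * S)) ^ 2 := by
  field_simp
  ring

/-- Completing the square: the product of two heat Gaussians is the Gaussian of the combined
displacement times a bridge factor. -/
theorem heat_exponent_add {P Q S y c : ℝ} (hP : 0 < P) (hQ : 0 < Q)
    (h : S ^ 2 = P ^ 2 + Q ^ 2) :
    -(y + c) ^ 2 / (4 * S ^ 2) + -((y * (Q / P) - c * (P / Q)) / (2 * S)) ^ 2
      = -y ^ 2 / (4 * P ^ 2) + -c ^ 2 / (4 * Q ^ 2) := by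
  rw [div_pow, mul_pow 2 S, h]
  field_simp
  ring

/-- Once both error functions carry the same Gaussian `E`, the `c` terms of their derivatives cancel
and only the `y` terms survive. The uncollected fractions are the derivatives of `√σ / √(s - σ)` and
its inverse as the quotient rule produces them; `R` stands for `√π`. -/
theorem heat_weight {P Q S R y c s σ e₀ e₁ e₂ E : ℝ} (hP : 0 < P) (hQ : 0 < Q) (hS : 0 < S)
    (hR : 0 < R) (h : S ^ 2 = P ^ 2 + Q ^ 2) (hσ : P ^ 2 = s - σ) (he : e₀ * E = e₁ * e₂) :
    e₀ / (2 * R * S) / R *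
      (E * ((y * ((1 / (2 * Q) * P - Q * (1 / (2 * P) * -1)) / P ^ 2)
          - c * ((1 / (2 * P) * -1 * Q - P * (1 / (2 * Q))) / Q ^ 2)) / (2 * S))
        + E * ((y * ((1 / (2 * Q) * P - Q * (1 / (2 * P) * -1)) / P ^ 2)
          + c * ((1 / (2 * P) * -1 * Q - P * (1 / (2 * Q))) / Q ^ 2)) / (2 * S)))
      = y / (s - σ) * (e₁ / (2 * R * P)) * (e₂ / (2 * R * Q)) := by
  have h1 : 1 / (2 * Q) * P - Q * (1 / (2 * P) * -1) = S ^ 2 / (2 * (P * Q)) := by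
    rw [h]; field_simp; ring
  have h2 : y / (s - σ) * (e₁ / (2 * R * P)) * (e₂ / (2 * R * Q))
      = y / (s - σ) * (e₀ * E) / (2 * R * P) / (2 * R * Q) := by rw [he]; field_simp
  rw [h2, h1, ← hσ]
  field_simp
  ring

/-- The convolution in time of the boundary kernel with the heat kernel: a Brownian path from `0`
to `y + c` passes through `c`. -/
theorem integral_boundaryKernel_mul_heatKernel {y c s : ℝ} (hy : 0 < y) (hc : 0 < c) (hs : 0 < s) :
    ∫ σ in (0 : ℝ)..s, boundaryKernel y (s - σ) * heatKernel σ c = heatKernel s (y + c) := by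
  have hpi : 0 < Real.sqrt Real.pi := Real.sqrt_pos.2 Real.pi_pos
  have hS : 0 < Real.sqrt s := Real.sqrt_pos.2 hs
  set q : ℝ → ℝ := fun σ => Real.sqrt σ / Real.sqrt (s - σ)
  set r : ℝ → ℝ := fun σ => Real.sqrt (s - σ) / Real.sqrt σ
  have hflip : Tendsto (fun σ => s - σ) (𝓝[<] s) (𝓝[>] 0) := by
    refine tendsto_nhdsWithin_iff.2 ⟨?_, ?_⟩
    · have : Tendsto (fun σ => s - σ) (𝓝 s) (𝓝 (s - s)) := (continuous_sub_left s).tendsto s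
      rw [sub_self] at this
      exact this.mono_left nhdsWithin_le_nhds
    · filter_upwards [self_mem_nhdsWithin] with σ (hσ : σ < s) using sub_pos.2 hσ
  have c1 : Tendsto (fun σ => Real.sqrt (s - σ)) (𝓝[>] 0) (𝓝 (Real.sqrt s)) := by
    have : Tendsto (fun σ => Real.sqrt (s - σ)) (𝓝 0) (𝓝 (Real.sqrt (s - 0))) :=
      (Real.continuous_sqrt.comp (continuous_sub_left s)).tendsto 0
    rw [sub_zero] at this
    exact this.mono_left nhdsWithin_le_nhds
  have c2 : Tendsto Real.sqrt (𝓝[<] s) (𝓝 (Real.sqrt s)) :=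
    (Real.continuous_sqrt.tendsto s).mono_left nhdsWithin_le_nhds
  have q0 : Tendsto q (𝓝[>] 0) (𝓝 0) := by
    have := (tendsto_sqrt_nhdsGT_zero.mono_right nhdsWithin_le_nhds).div c1 hS.ne'
    rwa [zero_div] at this
  have rs : Tendsto r (𝓝[<] s) (𝓝 0) := by
    have := ((tendsto_sqrt_nhdsGT_zero.comp hflip).mono_right nhdsWithin_le_nhds).div c2 hS.ne'
    rwa [zero_div] at this
  have r0 : Tendsto r (𝓝[>] 0) atTop :=
    c1.pos_mul_atTop hS (tendsto_inv_nhdsGT_zero.comp tendsto_sqrt_nhdsGT_zero)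
  have qs : Tendsto q (𝓝[<] s) atTop :=
    c2.pos_mul_atTop hS
      (tendsto_inv_nhdsGT_zero.comp (tendsto_sqrt_nhdsGT_zero.comp hflip))
  set C : ℝ := heatKernel s (y + c) / Real.sqrt Real.pi with hC
  set D : ℝ := Real.exp (y * c / s) with hD
  -- Explicit antiderivative. The factor `D` equalises the two Gaussians. The first argument runs
  -- from `-∞` to `∞`, while the second tends to `+∞` at both ends, so the `D` terms cancel and `C
  -- √π = K(s, y + c)` remains.
  have key := intervalIntegral_of_hasDerivAt_of_tendsto_of_nonneg hs
    (f := fun σ => C * (gaussPrimitive ((y * q σ - c * r σ) / (2 * Real.sqrt s))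
      + D * gaussPrimitive ((y * q σ + c * r σ) / (2 * Real.sqrt s))))
    (f' := fun σ => boundaryKernel y (s - σ) * heatKernel σ c)
    (fa := C * (-(Real.sqrt Real.pi / 2) + D * (Real.sqrt Real.pi / 2)))
    (fb := C * (Real.sqrt Real.pi / 2 + D * (Real.sqrt Real.pi / 2))) ?_
    (fun σ hσ => mul_nonneg (boundaryKernel_nonneg hy.le (sub_pos.2 hσ.2).le)
      (heatKernel_nonneg _ _)) ?_ ?_
  · rw [key.2, hC]; field_simp; ring
  · intro σ hσ
    have hσ0 : 0 < σ := hσ.1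
    have hσs : 0 < s - σ := sub_pos.2 hσ.2
    have hQ : 0 < Real.sqrt σ := Real.sqrt_pos.2 hσ0
    have hP : 0 < Real.sqrt (s - σ) := Real.sqrt_pos.2 hσs
    have dQ := Real.hasDerivAt_sqrt hσ0.ne'
    have dP : HasDerivAt (fun σ => Real.sqrt (s - σ)) (1 / (2 * Real.sqrt (s - σ)) * -1) σ :=
      (Real.hasDerivAt_sqrt hσs.ne').comp σ ((hasDerivAt_id σ).const_sub s)
    have dq := dQ.div dP hP.ne'
    have dr := dP.div dQ hQ.ne'
    have dA := ((dq.const_mul y).sub (dr.const_mul c)).div_const (2 * Real.sqrt s)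
    have dB := ((dq.const_mul y).add (dr.const_mul c)).div_const (2 * Real.sqrt s)
    have dF := (((hasDerivAt_gaussPrimitive _).comp σ dA).add
      (((hasDerivAt_gaussPrimitive _).comp σ dB).const_mul D)).const_mul C
    refine dF.congr_deriv ?_
    simp only [Pi.sub_apply, Pi.add_apply, Pi.div_apply]
    have hPsq := Real.sq_sqrt hσs.le
    have hQsq := Real.sq_sqrt hσ0.le
    have hSsq := Real.sq_sqrt hs.le
    have eB : D * Real.exp (-((y * (Real.sqrt σ / Real.sqrt (s - σ))
        + c * (Real.sqrt (s - σ) / Real.sqrt σ)) / (2 * Real.sqrt s)) ^ 2)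
        = Real.exp (-((y * (Real.sqrt σ / Real.sqrt (s - σ))
        - c * (Real.sqrt (s - σ) / Real.sqrt σ)) / (2 * Real.sqrt s)) ^ 2) := by
      have h := heat_exponent_sub (y := y) (c := c) hP hQ hS
      rw [hSsq, sub_eq_add_neg] at h
      rw [hD, ← Real.exp_add, h]
    have eA : Real.exp (-(y + c) ^ 2 / (4 * s)) * Real.exp (-((y * (Real.sqrt σ / Real.sqrt (s - σ))
        - c * (Real.sqrt (s - σ) / Real.sqrt σ)) / (2 * Real.sqrt s)) ^ 2)
        = Real.exp (-y ^ 2 / (4 * (s - σ))) * Real.exp (-c ^ 2 / (4 * σ)) := by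
      have h := heat_exponent_add (y := y) (c := c) (S := Real.sqrt s) hP hQ (by rw [hPsq, hQsq, hSsq]; ring)
      rw [hPsq, hQsq, hSsq] at h
      rw [← Real.exp_add, ← Real.exp_add, h]
    rw [← mul_assoc D, eB]
    have hC' : C = Real.exp (-(y + c) ^ 2 / (4 * s)) / (2 * Real.sqrt Real.pi * Real.sqrt s)
        / Real.sqrt Real.pi := by rw [hC, heatKernel, sqrt_four_pi_mul]
    unfold boundaryKernel heatKernel
    rw [sqrt_four_pi_mul, sqrt_four_pi_mul, hC']
    generalize Real.exp (-((y * (Real.sqrt σ / Real.sqrt (s - σ))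
        - c * (Real.sqrt (s - σ) / Real.sqrt σ)) / (2 * Real.sqrt s)) ^ 2) = E at *
    exact heat_weight hP hQ hS hpi (by rw [hPsq, hQsq, hSsq]; ring) hPsq eA
  · have hA : Tendsto (fun σ => (y * q σ - c * r σ) / (2 * Real.sqrt s)) (𝓝[>] 0) atBot := by
      refine Tendsto.atBot_div_const (by positivity) ?_
      exact (q0.const_mul y).add_atBot (tendsto_neg_atTop_atBot.comp (r0.const_mul_atTop hc))
    have hB : Tendsto (fun σ => (y * q σ + c * r σ) / (2 * Real.sqrt s)) (𝓝[>] 0) atTop :=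
      ((q0.const_mul y).add_atTop (r0.const_mul_atTop hc)).atTop_div_const (by positivity)
    exact ((tendsto_gaussPrimitive_atBot.comp hA).add
      ((tendsto_gaussPrimitive_atTop.comp hB).const_mul D)).const_mul C
  · have hA : Tendsto (fun σ => (y * q σ - c * r σ) / (2 * Real.sqrt s)) (𝓝[<] s) atTop := by
      refine Tendsto.atTop_div_const (by positivity) ?_
      exact (qs.const_mul_atTop hy).atTop_add (rs.const_mul c).neg
    have hB : Tendsto (fun σ => (y * q σ + c * r σ) / (2 * Real.sqrt s)) (𝓝[<] s) atTop :=
      ((qs.const_mul_atTop hy).atTop_add (rs.const_mul c)).atTop_div_const (by positivity)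
    exact ((tendsto_gaussPrimitive_atTop.comp hA).add
      ((tendsto_gaussPrimitive_atTop.comp hB).const_mul D)).const_mul C

/-! ### Point evaluation as a continuous functional on `H¹(ℝ)` -/

theorem coeFn_add_fst (v w : H1) : ((v + w : H1) : WithLp 2 (L2 × L2)).fst
    =ᵐ[volume] fun x => (v : WithLp 2 (L2 × L2)).fst x + (w : WithLp 2 (L2 × L2)).fst x :=
  Lp.coeFn_add _ _

/-- `pt` is defined by choice, so its linearity rests on uniqueness of the continuous
representative. -/
theorem pt_add (v w : H1) (x : ℝ) : pt (v + w) x = pt v x + pt w x := by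
  refine congrFun (pt_eq_of_ae_eq ((continuous_pt v).add (continuous_pt w)) ?_) x
  filter_upwards [coeFn_add_fst v w, pt_ae_eq v, pt_ae_eq w] with z h1 h2 h3
  simp only [h1, Pi.add_apply, h2, h3]

theorem pt_smul (c : ℝ) (v : H1) (x : ℝ) : pt (c • v) x = c * pt v x := by
  refine congrFun (pt_eq_of_ae_eq (w := fun x => c * pt v x)
    (continuous_const.mul (continuous_pt v)) ?_) x
  have h : ((c • v : H1) : WithLp 2 (L2 × L2)).fst
    =ᵐ[volume] c • ⇑(v : WithLp 2 (L2 × L2)).fst := Lp.coeFn_smul _ _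
  filter_upwards [h, pt_ae_eq v] with z h1 h2
  rw [h1, Pi.smul_apply, h2, smul_eq_mul]

/-- A function and the primitive of its weak derivative differ by a constant almost everywhere;
uniqueness then identifies `pt v` with that explicit continuous representative. -/
theorem pt_sub_pt (v : H1) (x y : ℝ) :
    pt v y - pt v x = ∫ z in x..y, (v : WithLp 2 (L2 × L2)).snd z := by
  obtain ⟨hf, hg, H⟩ := v.2
  rw [locallyIntegrableOn_univ] at hf hg
  have hgi := locallyIntegrable_intervalIntegrable hg
  have hGc : Continuous fun x : ℝ => ∫ y in (0 : ℝ)..x, (v : WithLp 2 (L2 × L2)).snd y :=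
    intervalIntegral.continuous_primitive hgi 0
  obtain ⟨c, hc⟩ := ae_const_of_weakDeriv_zero (hf.sub hGc.locallyIntegrable) (by
    intro φ hφ hφc
    have hd : Continuous (deriv φ) := hφ.continuous_deriv (by simp)
    have i1 : Integrable fun x => (v : WithLp 2 (L2 × L2)).fst x * deriv φ x := by
      simpa [mul_comm] using hf.integrable_smul_left_of_hasCompactSupport hd hφc.deriv
    have i2 : Integrable fun x =>
        (∫ y in (0 : ℝ)..x, (v : WithLp 2 (L2 × L2)).snd y) * deriv φ x :=
      (hGc.mul hd).integrable_of_hasCompactSupport hφc.deriv.mul_left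
    simp only [Pi.sub_apply, sub_mul]
    rw [integral_sub i1 i2, integral_primitive_mul_deriv hg hφ hφc,
      H φ hφ hφc (subset_univ _)]
    ring)
  have e : pt v = fun x => c + ∫ y in (0 : ℝ)..x, (v : WithLp 2 (L2 × L2)).snd y := by
    refine pt_eq_of_ae_eq (continuous_const.add hGc) ?_
    filter_upwards [hc] with x hx
    simp only [Pi.sub_apply] at hx
    linarith
  rw [e, ← intervalIntegral.integral_interval_sub_left (hgi 0 y) (hgi 0 x)]
  ring

/-- Cauchy–Schwarz on an interval of length one. -/
theorem setIntegral_Icc_norm_le (f : L2) (x : ℝ) : ∫ z in Icc x (x + 1), ‖f z‖ ≤ ‖f‖ := by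
  have hm : MemLp f 2 (volume.restrict (Icc x (x + 1))) := (Lp.memLp f).restrict _
  rw [integral_norm_eq_lintegral_enorm hm.1, ← eLpNorm_one_eq_lintegral_enorm]
  refine ENNReal.toReal_mono (Lp.eLpNorm_ne_top f) ?_
  refine (eLpNorm_le_eLpNorm_mul_rpow_measure_univ (one_le_two) hm.1).trans ?_
  simp only [Measure.restrict_apply_univ, Real.volume_Icc]
  simpa using eLpNorm_mono_measure (p := 2) f (Measure.restrict_le_self (μ := volume))

/-- Average `|v(x)| ≤ |v(y)| + ‖v'‖` over `y` in `[x, x + 1]`. The constant is not sharp; only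
boundedness of evaluation matters. -/
theorem abs_pt_le (v : H1) (x : ℝ) : |pt v x| ≤ 2 * ‖v‖ := by
  set f := (v : WithLp 2 (L2 × L2)).fst with hf
  set g := (v : WithLp 2 (L2 × L2)).snd with hg
  have nf : ‖f‖ ≤ ‖v‖ := WithLp.norm_fst_le _ (v : WithLp 2 (L2 × L2))
  have ng : ‖g‖ ≤ ‖v‖ := WithLp.norm_snd_le _ (v : WithLp 2 (L2 × L2))
  have hgi : IntegrableOn (fun z => ‖g z‖) (Icc x (x + 1)) :=
    ((L2_locallyIntegrable g).integrableOn_isCompact isCompact_Icc).norm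
  have hp : ∀ y ∈ Icc x (x + 1), |pt v x| ≤ |pt v y| + ‖g‖ := by
    intro y hy
    have h1 := pt_sub_pt v x y
    have h2 : |pt v y - pt v x| ≤ ‖g‖ := by
      rw [h1, intervalIntegral.integral_of_le hy.1]
      refine (norm_integral_le_integral_norm _).trans ((setIntegral_mono_set hgi
        (ae_of_all _ fun _ => norm_nonneg _) ?_).trans (setIntegral_Icc_norm_le g x))
      exact LE.le.eventuallyLE fun z hz => ⟨hz.1.le, hz.2.trans hy.2⟩
    rw [abs_sub_comm] at h2
    linarith [abs_sub_abs_le_abs_sub (pt v x) (pt v y)]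
  have hc : IntegrableOn (fun y => |pt v y| + ‖g‖) (Icc x (x + 1)) :=
    ((continuous_pt v).abs.add continuous_const).integrableOn_Icc
  have h3 := setIntegral_mono_on (integrableOn_const (by simp)) hc measurableSet_Icc hp
  have h4 : ∫ y in Icc x (x + 1), |pt v y| ≤ ‖f‖ := by
    refine le_trans (le_of_eq ?_) (setIntegral_Icc_norm_le f x)
    refine setIntegral_congr_ae measurableSet_Icc ?_
    filter_upwards [pt_ae_eq v] with z hz _
    rw [hz, Real.norm_eq_abs]
  rw [integral_add (continuous_pt v).abs.integrableOn_Icc (integrableOn_const (by simp))] at h3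
  simp at h3
  linarith

/-- Evaluation at `x` as a continuous linear functional on `H¹(ℝ)`. -/
def ptCLM (x : ℝ) : H1 →L[ℝ] ℝ :=
  LinearMap.mkContinuous
    { toFun := fun v => pt v x
      map_add' := fun v w => pt_add v w x
      map_smul' := fun c v => pt_smul c v x } 2 fun v => abs_pt_le v x

theorem ptCLM_apply (x : ℝ) (v : H1) : ptCLM x v = pt v x := rfl

/-- Here `Real.sqrt` is zero and division by zero gives zero. This default value makes the kernels
causal, so time integrals can be extended past the diagonal at no cost. -/
theorem heatKernel_of_nonpos {t : ℝ} (ht : t ≤ 0) (x : ℝ) : heatKernel t x = 0 := by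
  rw [heatKernel, Real.sqrt_eq_zero_of_nonpos, div_zero]
  exact mul_nonpos_of_nonneg_of_nonpos (by positivity) ht

theorem pt_heatDirac (t x : ℝ) : pt (heatDirac t) x = heatKernel t x := by
  rcases le_or_gt t 0 with ht | ht
  · rw [heatKernel_of_nonpos ht, heatDirac, dif_neg ht.not_gt, ← ptCLM_apply, map_zero]
  refine congrFun (pt_eq_of_ae_eq ?_ ?_) x
  · exact continuous_iff_continuousAt.2 fun x => (hasDerivAt_heatKernel t x).continuousAt
  · simp only [heatDirac, dif_pos ht]
    exact (memLp_heatKernel ht).coeFn_toLp.symm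

/-! ### The heat flow of an element of `H¹(ℝ)` -/

theorem continuous_heatKernel (t : ℝ) : Continuous (heatKernel t) :=
  continuous_iff_continuousAt.2 fun x => (hasDerivAt_heatKernel t x).continuousAt

theorem heatKernel_le (t x : ℝ) : heatKernel t x ≤ (Real.sqrt (4 * Real.pi * t))⁻¹ := by
  rcases le_or_gt t 0 with ht | ht
  · rw [heatKernel_of_nonpos ht]; positivity
  · rw [heatKernel, ← one_div]
    gcongr
    refine Real.exp_le_one_iff.2 (div_nonpos_of_nonpos_of_nonneg ?_ (by positivity))
    nlinarith [sq_nonneg x]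

theorem heatKernel_neg (t x : ℝ) : heatKernel t (-x) = heatKernel t x := by
  simp [heatKernel]

theorem heatKernel_integral {t : ℝ} (ht : 0 < t) :
    Integrable (heatKernel t) ∧ ∫ x, heatKernel t x = 1 := by
  have e : heatKernel t = fun x =>
      Real.exp (-(1 / (4 * t)) * x ^ 2) / Real.sqrt (4 * Real.pi * t) := by
    funext x
    unfold heatKernel
    congr 2
    field_simp
  have h4 : Real.pi / (1 / (4 * t)) = 4 * Real.pi * t := by field_simp
  rw [e]
  refine ⟨(integrable_exp_neg_mul_sq (by positivity)).div_const _, ?_⟩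
  rw [integral_div, integral_gaussian, h4]
  exact div_self (Real.sqrt_pos.2 (by positivity)).ne'

/-- The value `(e^{tΔ} f)(x)`. -/
def heatFlow (f : H1) (t x : ℝ) : ℝ := ∫ y, heatKernel t (x - y) * pt f y

/-- In this form `x` appears only in the bounded factor, so the kernel itself serves as the
dominating function. -/
theorem heatFlow_eq (f : H1) (t x : ℝ) :
    heatFlow f t x = ∫ z, heatKernel t z * pt f (x - z) := by
  have := integral_sub_left_eq_self (fun z => heatKernel t z * pt f (x - z)) volume x
  simpa [heatFlow] using this

theorem continuous_heatFlow (f : H1) {t : ℝ} (ht : 0 < t) : Continuous (heatFlow f t) := by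
  simp only [funext (heatFlow_eq f t)]
  refine continuous_of_dominated (bound := fun z => heatKernel t z * (2 * ‖f‖)) (fun x => ?_)
    (fun x => ae_of_all _ fun z => ?_) ((heatKernel_integral ht).1.mul_const _)
    (ae_of_all _ fun z => ?_)
  · exact ((continuous_heatKernel t).mul
      ((continuous_pt f).comp (continuous_sub_left x))).aestronglyMeasurable
  · rw [norm_mul, Real.norm_of_nonneg (heatKernel_nonneg t z)]
    exact mul_le_mul_of_nonneg_left (abs_pt_le f _) (heatKernel_nonneg t z)
  · exact continuous_const.mul ((continuous_pt f).comp (continuous_sub_right z))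

theorem IsHeatFlow.pt_eq {f v : H1} {t : ℝ} (ht : 0 < t) (h : IsHeatFlow t f v) (x : ℝ) :
    pt v x = heatFlow f t x :=
  congrFun (((continuous_pt v).ae_eq_iff_eq volume (continuous_heatFlow f ht)).1 h) x

theorem abs_heatFlow_le (f : H1) {t : ℝ} (ht : 0 < t) (x : ℝ) :
    |heatFlow f t x| ≤ 2 * ‖f‖ := by
  rw [heatFlow_eq, ← Real.norm_eq_abs]
  refine (norm_integral_le_of_norm_le ((heatKernel_integral ht).1.mul_const (2 * ‖f‖))
    (ae_of_all _ fun z => ?_)).trans_eq ?_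
  · rw [norm_mul, Real.norm_of_nonneg (heatKernel_nonneg t z)]
    exact mul_le_mul_of_nonneg_left (abs_pt_le f _) (heatKernel_nonneg t z)
  · rw [integral_mul_const, (heatKernel_integral ht).2, one_mul]

theorem measurable_heatKernel_uncurry : Measurable (Function.uncurry heatKernel) := by
  unfold Function.uncurry heatKernel
  fun_prop

theorem measurable_heatFlow (f : H1) (x : ℝ) : Measurable fun t => heatFlow f t x := by
  refine StronglyMeasurable.measurable (StronglyMeasurable.integral_prod_right
    (f := fun t y => heatKernel t (x - y) * pt f y) ?_)
  refine Measurable.stronglyMeasurable ?_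
  exact (measurable_heatKernel_uncurry.comp (measurable_fst.prodMk
    (measurable_const.sub measurable_snd))).mul
    ((continuous_pt f).measurable.comp measurable_snd)

theorem integrable_pt_sq (f : H1) : Integrable fun y => pt f y ^ 2 := by
  have h : MemLp (pt f) 2 volume := (memLp_congr_ae (pt_ae_eq f)).2 (Lp.memLp _)
  exact (memLp_two_iff_integrable_sq (continuous_pt f).aestronglyMeasurable).1 h

/-- Cauchy–Schwarz in `L²`, where the norm of the kernel is of order `t^(-1/4)`. It is carried out
pointwise as `k|w| ≤ (l/2) k² + w² / (2l)` with `l = t^(1/4)`, together with `k ≤ (2√π l²)⁻¹` and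
the unit mass of the kernel. -/
theorem tendsto_heatFlow (f : H1) (x : ℝ) :
    Tendsto (fun t => heatFlow f t x) atTop (𝓝 0) := by
  set S : ℝ := ∫ y, pt f y ^ 2 with hS
  have hpi : 0 < Real.sqrt Real.pi := Real.sqrt_pos.2 Real.pi_pos
  refine squeeze_zero_norm' (a := fun t => ((4 * Real.sqrt Real.pi)⁻¹ + S / 2) *
    (Real.sqrt (Real.sqrt t))⁻¹) ?_ ?_
  · filter_upwards [eventually_gt_atTop 0] with t ht
    set l : ℝ := Real.sqrt (Real.sqrt t) with hl
    have hl0 : 0 < l := Real.sqrt_pos.2 (Real.sqrt_pos.2 ht)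
    have hl2 : l ^ 2 = Real.sqrt t := Real.sq_sqrt (Real.sqrt_nonneg t)
    have hs : Real.sqrt (4 * Real.pi * t) = 2 * Real.sqrt Real.pi * l ^ 2 := by
      rw [sqrt_four_pi_mul, hl2]
    have i1 : Integrable fun z => (4 * Real.sqrt Real.pi)⁻¹ * l⁻¹ * heatKernel t z :=
      (heatKernel_integral ht).1.const_mul _
    have i2 : Integrable fun z => l⁻¹ / 2 * pt f (x - z) ^ 2 :=
      ((integrable_pt_sq f).comp_sub_left x).const_mul _
    rw [heatFlow_eq]
    refine (norm_integral_le_of_norm_le (i1.add i2) (ae_of_all _ fun z => ?_)).trans_eq ?_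
    · have hK := heatKernel_le t z
      have hK0 := heatKernel_nonneg t z
      rw [hs] at hK
      rw [norm_mul, Real.norm_of_nonneg hK0, Real.norm_eq_abs, Pi.add_apply]
      set k := heatKernel t z
      set w := pt f (x - z)
      have h1 : l / 2 * (k * k) ≤ l / 2 * (k * (2 * Real.sqrt Real.pi * l ^ 2)⁻¹) := by gcongr
      have h2 : l / 2 * (k * (2 * Real.sqrt Real.pi * l ^ 2)⁻¹)
          = (4 * Real.sqrt Real.pi)⁻¹ * l⁻¹ * k := by field_simp; ring
      have h3 : l / 2 * (k * k) + l⁻¹ / 2 * w ^ 2 - k * |w| = l / 2 * (k - l⁻¹ * |w|) ^ 2 := by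
        rw [← sq_abs w]; field_simp; ring
      have h4 : 0 ≤ l / 2 * (k - l⁻¹ * |w|) ^ 2 := by positivity
      linarith
    · have e : ∫ z, pt f (x - z) ^ 2 = S :=
        integral_sub_left_eq_self (fun y => pt f y ^ 2) volume x
      simp only [Pi.add_apply]
      rw [integral_add i1 i2, integral_const_mul, integral_const_mul, e,
        (heatKernel_integral ht).2]
      ring
  · have := (tendsto_inv_atTop_zero.comp
      (Real.tendsto_sqrt_atTop.comp Real.tendsto_sqrt_atTop)).const_mul
      ((4 * Real.sqrt Real.pi)⁻¹ + S / 2)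
    rwa [mul_zero] at this

/-! ### Duhamel's formula -/

theorem continuousOn_pt {u : ℝ → H1} {s : Set ℝ} (hu : ContinuousOn u s) (x : ℝ) :
    ContinuousOn (fun t => pt (u t) x) s :=
  (ptCLM x).continuous.comp_continuousOn hu

theorem source_integrableOn {a : ℝ} {Φ : ℝ → ℝ} (hΦ : LocBounded Φ) {u : ℝ → H1}
    (hu : ContinuousOn u (Ici 0)) {t : ℝ} (ht : 0 < t) :
    IntegrableOn (source a Φ u) (Ioc 0 t) := by
  have h1 : IntegrableOn Φ (Icc 0 t) := (hΦ t ht).integrable le_top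
  have h2 : IntegrableOn (fun τ => a * (pt (u τ) 1 + pt (u τ) (-1))) (Icc 0 t) :=
    ContinuousOn.integrableOn_Icc ((continuousOn_const.mul
      ((continuousOn_pt hu 1).add (continuousOn_pt hu (-1)))).mono Icc_subset_Ici_self)
  exact (h1.sub h2).mono_set Ioc_subset_Icc_self

/-- Evaluation is a continuous functional, so it passes through the Bochner integral. -/
theorem IsMildSolution.pt_eq {a : ℝ} {Φ : ℝ → ℝ} {u₀ : H1} {u : ℝ → H1}
    (hu : IsMildSolution a Φ u₀ u) {t : ℝ} (ht : 0 < t) (x : ℝ) :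
    pt (u t) x = heatFlow u₀ t x
      + ∫ τ in (0 : ℝ)..t, source a Φ u τ * heatKernel (t - τ) x := by
  have h1 := (hu.variation_of_constants t ht).pt_eq ht x
  have h2 := (ptCLM x).intervalIntegral_comp_comm (hu.integrable t ht)
  simp only [ptCLM_apply, pt_smul, pt_heatDirac] at h2
  rw [← h1, h2, ← pt_add, sub_add_cancel]

/-! ### The boundary value problem on a half-line -/

theorem boundaryKernel_of_nonpos {y t : ℝ} (ht : t ≤ 0) : boundaryKernel y t = 0 := by
  rw [boundaryKernel, heatKernel_of_nonpos ht, mul_zero]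

theorem integrable_boundaryKernel {y : ℝ} (hy : 0 < y) : Integrable (boundaryKernel y) := by
  rw [← integrableOn_iff_integrable_of_support_subset (s := Ioi 0)]
  · exact (boundaryKernel_integral hy).1
  · exact fun t ht => not_le.1 fun h => ht (boundaryKernel_of_nonpos h)

theorem integral_boundaryKernel {y : ℝ} (hy : 0 < y) : ∫ t, boundaryKernel y t = 1 := by
  rw [← (boundaryKernel_integral hy).2]
  exact (setIntegral_eq_integral_of_forall_compl_eq_zero fun t ht =>
    boundaryKernel_of_nonpos (not_lt.1 ht)).symm

/-- If the boundary data converge as `t → ∞`, then so does the solution of the boundary value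
problem, to the same limit. -/
theorem tendsto_integral_boundaryKernel {y : ℝ} (hy : 0 < y) {g : ℝ → ℝ} {M L : ℝ}
    (hg : AEStronglyMeasurable g (volume.restrict (Ioi 0))) (hM : ∀ t, 0 < t → |g t| ≤ M)
    (hL : Tendsto g atTop (𝓝 L)) :
    Tendsto (fun t => ∫ σ in (0 : ℝ)..t, boundaryKernel y (t - σ) * g σ) atTop (𝓝 L) := by
  -- Extension by zero makes the Volterra integral a convolution over all of `ℝ`, whose domain no
  -- longer depends on `t`.
  set G : ℝ → ℝ := (Ioi 0).indicator g with hG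
  have hGm : AEStronglyMeasurable G volume :=
    (aestronglyMeasurable_indicator_iff measurableSet_Ioi).2 hg
  have hM0 : 0 ≤ M := (abs_nonneg _).trans (hM 1 one_pos)
  have hGM : ∀ t, |G t| ≤ M := fun t => by
    by_cases ht : 0 < t
    · rw [hG, indicator_of_mem (show t ∈ Ioi 0 from ht)]; exact hM t ht
    · rw [hG, indicator_of_notMem (show t ∉ Ioi 0 from ht), abs_zero]; exact hM0
  have hGL : Tendsto G atTop (𝓝 L) := hL.congr' (by
    filter_upwards [eventually_gt_atTop 0] with t ht
    rw [hG, indicator_of_mem (show t ∈ Ioi 0 from ht)])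
  have key : Tendsto (fun t => ∫ s, boundaryKernel y s * G (t - s)) atTop
      (𝓝 (∫ s, boundaryKernel y s * L)) := by
    refine tendsto_integral_filter_of_dominated_convergence
      (fun s => ‖boundaryKernel y s‖ * M) (Eventually.of_forall fun t => ?_)
      (Eventually.of_forall fun t => ae_of_all _ fun s => ?_)
      ((integrable_boundaryKernel hy).norm.mul_const M) (ae_of_all _ fun s => ?_)
    · exact (integrable_boundaryKernel hy).1.mul
        (hGm.comp_quasiMeasurePreserving (quasiMeasurePreserving_sub_left volume t))
    · rw [norm_mul]
      exact mul_le_mul_of_nonneg_left (hGM _) (norm_nonneg _)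
    · exact (hGL.comp (tendsto_atTop_add_const_right _ (-s) tendsto_id)).const_mul _
  rw [integral_mul_const, integral_boundaryKernel hy, one_mul] at key
  refine key.congr' ?_
  filter_upwards [eventually_gt_atTop 0] with t ht
  rw [← integral_sub_left_eq_self (fun s => boundaryKernel y s * G (t - s)) volume t]
  simp only [sub_sub_cancel]
  rw [intervalIntegral.integral_of_le ht.le]
  rw [← setIntegral_eq_integral_of_forall_compl_eq_zero (s := Ioc 0 t)]
  · refine setIntegral_congr_fun measurableSet_Ioc fun σ hσ => ?_
    simp only [hG]
    rw [indicator_of_mem (show σ ∈ Ioi 0 from hσ.1)]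
  · intro σ hσ
    by_cases h0 : 0 < σ
    · rw [boundaryKernel_of_nonpos, zero_mul]
      by_contra h
      exact hσ ⟨h0, by linarith⟩
    · rw [hG, indicator_of_notMem (show σ ∉ Ioi 0 from h0), mul_zero]

/-- Away from the source the kernel is bounded uniformly in time, which supplies the integrability
for Fubini below. From `x ≤ eˣ`, the square of the numerator is at most `2r`, hence at most `4πr`.
-/
theorem heatKernel_one_le (r : ℝ) : heatKernel r 1 ≤ 1 := by
  rcases le_or_gt r 0 with hr | hr
  · rw [heatKernel_of_nonpos hr]; exact zero_le_one
  rw [heatKernel, div_le_one (Real.sqrt_pos.2 (by positivity))]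
  refine Real.le_sqrt_of_sq_le ?_
  have h1 : Real.exp (-1 ^ 2 / (4 * r)) ^ 2 = (Real.exp (1 / (2 * r)))⁻¹ := by
    rw [← Real.exp_neg, ← Real.exp_nat_mul]
    congr 1
    push_cast
    field_simp
    ring
  have h2 : 1 / (2 * r) ≤ Real.exp (1 / (2 * r)) := by
    linarith [Real.add_one_le_exp (1 / (2 * r))]
  have h3 : (Real.exp (1 / (2 * r)))⁻¹ ≤ (1 / (2 * r))⁻¹ := inv_anti₀ (by positivity) h2
  rw [h1]
  refine h3.trans ?_
  rw [one_div, inv_inv]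
  nlinarith [Real.pi_gt_three]

/-- The heat potential of a source at distance `1` from the boundary of a half-line solves
the boundary value problem with its own boundary values. -/
theorem integral_boundaryKernel_mul_potential {y t : ℝ} (hy : 0 < y) (ht : 0 < t) {Ψ : ℝ → ℝ}
    (hΨ : IntegrableOn Ψ (Ioc 0 t)) :
    ∫ σ in (0 : ℝ)..t, boundaryKernel y (t - σ) *
        ∫ τ in (0 : ℝ)..σ, Ψ τ * heatKernel (σ - τ) 1
      = ∫ τ in (0 : ℝ)..t, Ψ τ * heatKernel (t - τ) (y + 1) := by
  -- By causality the triangle `τ < σ` may be replaced by the full square, so Fubini applies to a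
  -- product domain.
  have e1 : ∀ σ ∈ Ioc 0 t, boundaryKernel y (t - σ) *
      (∫ τ in (0 : ℝ)..σ, Ψ τ * heatKernel (σ - τ) 1)
      = ∫ τ in Ioc 0 t, boundaryKernel y (t - σ) * (Ψ τ * heatKernel (σ - τ) 1) := by
    intro σ hσ
    rw [intervalIntegral.integral_of_le hσ.1.le, integral_const_mul]
    congr 1
    refine (setIntegral_eq_of_subset_of_forall_sdiff_eq_zero measurableSet_Ioc
      (Ioc_subset_Ioc_right hσ.2) fun τ hτ => ?_).symm
    rw [heatKernel_of_nonpos, mul_zero]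
    by_contra h
    exact hτ.2 ⟨hτ.1.1, by linarith⟩
  have e2 : ∀ τ ∈ Ioc 0 t, ∫ σ in Ioc 0 t, boundaryKernel y (t - σ) *
      (Ψ τ * heatKernel (σ - τ) 1) = Ψ τ * heatKernel (t - τ) (y + 1) := by
    intro τ hτ
    have h1 : ∫ σ in Ioc 0 t, boundaryKernel y (t - σ) * (Ψ τ * heatKernel (σ - τ) 1)
        = Ψ τ * ∫ σ in Ioc 0 t, boundaryKernel y (t - σ) * heatKernel (σ - τ) 1 := by
      rw [← integral_const_mul]
      congr 1
      funext σ
      ring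
    have h2 : ∫ σ in Ioc 0 t, boundaryKernel y (t - σ) * heatKernel (σ - τ) 1
        = ∫ σ in τ..t, boundaryKernel y (t - σ) * heatKernel (σ - τ) 1 := by
      rw [intervalIntegral.integral_of_le hτ.2]
      refine setIntegral_eq_of_subset_of_forall_sdiff_eq_zero measurableSet_Ioc
        (Ioc_subset_Ioc_left hτ.1.le) fun σ hσ => ?_
      rw [heatKernel_of_nonpos, mul_zero]
      by_contra h
      exact hσ.2 ⟨by linarith, hσ.1.2⟩
    have h3 := intervalIntegral.integral_comp_sub_right (a := τ) (b := t)
      (fun σ => boundaryKernel y (t - τ - σ) * heatKernel σ 1) τ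
    simp only [sub_sub_sub_cancel_right, sub_self] at h3
    rw [h1, h2, h3]
    -- At `τ = t` the convolution identity is not available, but both sides vanish by the default
    -- value of the kernel.
    rcases hτ.2.eq_or_lt with rfl | hlt
    · rw [sub_self, intervalIntegral.integral_same, heatKernel_of_nonpos le_rfl]
    · rw [integral_boundaryKernel_mul_heatKernel hy one_pos (sub_pos.2 hlt)]
  have hi : Integrable (Function.uncurry fun σ τ =>
      boundaryKernel y (t - σ) * (Ψ τ * heatKernel (σ - τ) 1))
      ((volume.restrict (Ioc 0 t)).prod (volume.restrict (Ioc 0 t))) := by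
    have h1 : Integrable (fun σ => boundaryKernel y (t - σ)) (volume.restrict (Ioc 0 t)) :=
      ((integrable_boundaryKernel hy).comp_sub_left t).restrict
    have h2 := h1.mul_prod hΨ
    have h3 : AEStronglyMeasurable (fun z : ℝ × ℝ => heatKernel (z.1 - z.2) 1)
        ((volume.restrict (Ioc 0 t)).prod (volume.restrict (Ioc 0 t))) :=
      (measurable_heatKernel_uncurry.comp ((measurable_fst.sub measurable_snd).prodMk
        measurable_const)).aestronglyMeasurable
    refine (h2.bdd_mul (c := 1) h3 (ae_of_all _ fun z => ?_)).congr (ae_of_all _ fun z => ?_)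
    · rw [Real.norm_of_nonneg (heatKernel_nonneg _ _)]
      exact heatKernel_one_le _
    · simp only [Function.uncurry]
      ring
  rw [intervalIntegral.integral_of_le ht.le, intervalIntegral.integral_of_le ht.le,
    setIntegral_congr_fun measurableSet_Ioc e1, integral_integral_swap hi,
    setIntegral_congr_fun measurableSet_Ioc e2]

/-! ### Convergence of mild solutions beyond the points `±1` -/

theorem exists_abs_le_of_continuousOn_of_tendsto {b : ℝ → ℝ} {L : ℝ}
    (hb : ContinuousOn b (Ici 0)) (hL : Tendsto b atTop (𝓝 L)) :
    ∃ M, ∀ t, 0 ≤ t → |b t| ≤ M := by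
  obtain ⟨T, hT⟩ := eventually_atTop.1 (hL.abs.eventually (gt_mem_nhds (lt_add_one |L|)))
  obtain ⟨C, hC⟩ := isCompact_Icc.exists_bound_of_continuousOn
    (hb.mono (Icc_subset_Ici_self : Icc 0 T ⊆ Ici 0))
  refine ⟨max C (|L| + 1), fun t ht => ?_⟩
  rcases le_or_gt t T with h | h
  · exact (hC t ⟨ht, h⟩).trans (le_max_left _ _)
  · exact (hT t h.le).le.trans (le_max_right _ _)

/-- Convergence of a mild solution on the half-line bounded by one of the points `±1`. -/
theorem IsMildSolution.tendsto_pt {a : ℝ} {Φ : ℝ → ℝ} (hΦ : LocBounded Φ) {u₀ : H1}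
    {u : ℝ → H1} (hu : IsMildSolution a Φ u₀ u) {x₀ x y L : ℝ} (hy : 0 < y)
    (hx₀ : ∀ t, heatKernel t x₀ = heatKernel t 1)
    (hx : ∀ t, heatKernel t x = heatKernel t (y + 1))
    (hL : Tendsto (fun t => pt (u t) x₀) atTop (𝓝 L)) :
    Tendsto (fun t => pt (u t) x) atTop (𝓝 L) := by
  have hb := continuousOn_pt hu.continuousOn x₀
  obtain ⟨M, hM⟩ := exists_abs_le_of_continuousOn_of_tendsto hb hL
  -- The boundary data of the potential part, which starts from zero; removing the decaying free
  -- flow leaves the limit unchanged.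
  have hgL : Tendsto (fun t => pt (u t) x₀ - heatFlow u₀ t x₀) atTop (𝓝 L) := by
    simpa using hL.sub (tendsto_heatFlow u₀ x₀)
  have key := tendsto_integral_boundaryKernel hy (M := M + 2 * ‖u₀‖)
    (((hb.mono Ioi_subset_Ici_self).aestronglyMeasurable measurableSet_Ioi).sub
      (measurable_heatFlow u₀ x₀).aestronglyMeasurable)
    (fun t ht => (abs_sub _ _).trans (add_le_add (hM t ht.le) (abs_heatFlow_le u₀ ht x₀))) hgL
  have h0 := (tendsto_heatFlow u₀ x).add key
  rw [zero_add] at h0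
  refine h0.congr' ?_
  filter_upwards [eventually_gt_atTop 0] with t ht
  rw [hu.pt_eq ht x]
  simp only [hx]
  rw [← integral_boundaryKernel_mul_potential hy ht (source_integrableOn hΦ hu.continuousOn ht)]
  congr 1
  rw [intervalIntegral.integral_of_le ht.le, intervalIntegral.integral_of_le ht.le]
  refine setIntegral_congr_fun measurableSet_Ioc fun σ hσ => ?_
  simp only [Pi.sub_apply, hu.pt_eq hσ.1 x₀, hx₀, add_sub_cancel_left]

end DiracHeat

end

theorem proposition5p1 (a : ℝ) (Φ : ℝ → ℝ) (hΦ : DiracHeat.LocBounded Φ)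
    (u₀ : DiracHeat.H1) (u : ℝ → DiracHeat.H1) (hu : DiracHeat.IsMildSolution a Φ u₀ u)
    (hplus' : DiracHeat.HasIntegrableDeriv
      (fun t => DiracHeat.pt (u t) 1 + DiracHeat.pt (u t) (-1)))
    (hminus' : DiracHeat.HasIntegrableDeriv
      (fun t => DiracHeat.pt (u t) 1 - DiracHeat.pt (u t) (-1)))
    (hplus : ∃ L : ℝ,
      Tendsto (fun t => DiracHeat.pt (u t) 1 + DiracHeat.pt (u t) (-1)) atTop (𝓝 L))
    (hminus : ∃ L : ℝ,
      Tendsto (fun t => DiracHeat.pt (u t) 1 - DiracHeat.pt (u t) (-1)) atTop (𝓝 L)) :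
    ∃ ℓ₁ ℓ₂ : ℝ,
      Tendsto (fun t => DiracHeat.pt (u t) 1) atTop (𝓝 ℓ₁) ∧
      Tendsto (fun t => DiracHeat.pt (u t) (-1)) atTop (𝓝 ℓ₂) ∧
      (∀ x : ℝ, 1 ≤ x → Tendsto (fun t => DiracHeat.pt (u t) x) atTop (𝓝 ℓ₁)) ∧
      (∀ x : ℝ, x ≤ -1 → Tendsto (fun t => DiracHeat.pt (u t) x) atTop (𝓝 ℓ₂)) := by
  obtain ⟨P, hP⟩ := hplus
  obtain ⟨M, hM⟩ := hminus
  have h₁ : Tendsto (fun t => DiracHeat.pt (u t) 1) atTop (𝓝 ((P + M) / 2)) :=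
    ((hP.add hM).div_const 2).congr fun t => by ring
  have h₂ : Tendsto (fun t => DiracHeat.pt (u t) (-1)) atTop (𝓝 ((P - M) / 2)) :=
    ((hP.sub hM).div_const 2).congr fun t => by ring
  refine ⟨_, _, h₁, h₂, fun x hx => ?_, fun x hx => ?_⟩
  -- The boundary point is treated apart because the boundary kernel represents the solution only at
  -- positive distance `y`.
  · rcases hx.eq_or_lt with rfl | hlt
    · exact h₁
    · exact hu.tendsto_pt hΦ (sub_pos.2 hlt) (fun _ => rfl) (fun t => by rw [sub_add_cancel]) h₁
  · rcases hx.eq_or_lt with rfl | hlt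
    · exact h₂
    -- `y` is the distance from `x` to `-1`; evenness of the heat kernel reduces the left half-line
    -- to the right one.
    · refine hu.tendsto_pt (y := -x - 1) hΦ (by linarith)
        (fun t => DiracHeat.heatKernel_neg t 1) (fun t => ?_) h₂
      rw [sub_add_cancel, DiracHeat.heatKernel_neg]
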